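/- Let $M$ be a matrix with $t\ge 1$ columns and $u\ge 1$ rows whose entries $M_{i,j}$ ($i$ the column, numbered from the left, $j$ the row, numbered from the bottom) lie in $\{0,1,-1\}$. An $M$-gridding of a permutation $\sigma$ of $\{1,\dots,k\}$ consists of column dividers $\tfrac12=c_0\le c_1\le\dots\le c_t=k+\tfrac12$ and row dividers $\tfrac12=r_0\le r_1\le\dots\le r_u=k+\tfrac12$, with all $c_i-\tfrac12$ and $r_j-\tfrac12$ integers, such that for all $1\le i\le t$ and $1\le j\le u$ the subsequence of $\sigma$ with indices between $c_{i-1}$ and $c_i$ and values between $r_{j-1}$ and $r_j$ is increasing if $M_{i,j}=1$, decreasing if $M_{i,j}=-1$, and empty if $M_{i,j}=0$. The monotone grid class $\mathrm{Grid}(M)$ is the set of all permutations that have an $M$-gridding; let $\mathrm{Grid}_k(M)$ be the set of those of length $k$. The row-column graph $G(M)$ is the bipartite graph with one vertex for each column and one for each row of $M$, in which the vertex of column $i$ is adjacent to the vertex of row $j$ if and only if $M_{i,j}\ne 0$. Then the growth rate $g=\lim_{k\to\infty}|\mathrm{Grid}_k(M)|^{1/k}$ exists and is an algebraic integer. Moreover,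 $g=\rho^2$, where $\rho$ is the largest eigenvalue of the adjacency matrix (a $0/1$ matrix) of $G(M)$. -/

import Mathlib

open Filter Topology

/-- An `M`-gridding of a permutation `σ` of length `k`, where `M` is a `0/±1` matrix with `t` columns
and `u` rows, indexed as `M column row` from the lower left corner. Positions and values of `σ` are
numbered `0, …, k - 1`, and a divider at height `d + 1/2` is recorded as the natural number `d`: the
point `(p, σ p)` lies between the column dividers `c` and `c'` iff `c ≤ p < c'`, and likewise for
rows. -/
structure Gridding {t u k : ℕ} (M : Matrix (Fin t) (Fin u) SignType) (σ : Equiv.Perm (Fin k)) where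
  /-- The column dividers. -/
  col : Fin (t + 1) → ℕ
  /-- The row dividers. -/
  row : Fin (u + 1) → ℕ
  col_mono : Monotone col
  col_zero : col 0 = 0
  col_last : col (Fin.last t) = k
  row_mono : Monotone row
  row_zero : row 0 = 0
  row_last : row (Fin.last u) = k
  increasing : ∀ i j, M i j = 1 →
    StrictMonoOn σ {p | (col i.castSucc ≤ p ∧ p < col i.succ) ∧
      (row j.castSucc ≤ σ p ∧ σ p < row j.succ)}
  decreasing : ∀ i j, M i j = -1 →
    StrictAntiOn σ {p | (col i.castSucc ≤ p ∧ p < col i.succ) ∧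
      (row j.castSucc ≤ σ p ∧ σ p < row j.succ)}
  empty : ∀ i j, M i j = 0 →
    {p : Fin k | (col i.castSucc ≤ p ∧ p < col i.succ) ∧
      (row j.castSucc ≤ σ p ∧ σ p < row j.succ)} = ∅

/-- The monotone grid class of `M`: for each length `k`, the set of permutations of length `k` that
have an `M`-gridding. -/
def gridClass {t u : ℕ} (M : Matrix (Fin t) (Fin u) SignType) (k : ℕ) : Set (Equiv.Perm (Fin k)) :=
  {σ | Nonempty (Gridding M σ)}

/-- The collection `C` of permutations, `C k` being those of length `k`, has growth rate `g`:
the limit of `|C k| ^ (1 / k)` exists and equals `g`. -/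
def HasGrowthRate (C : (k : ℕ) → Set (Equiv.Perm (Fin k))) (g : ℝ) : Prop :=
  Tendsto (fun k : ℕ => ((C k).ncard : ℝ) ^ (1 / (k : ℝ))) atTop (𝓝 g)

/-- The row-column graph of `M`: the bipartite graph with a vertex `Sum.inl i` for each column `i`,
a vertex `Sum.inr j` for each row `j`, and an edge between them iff `M i j ≠ 0`. -/
def rowColumnGraph {t u : ℕ} (M : Matrix (Fin t) (Fin u) SignType) :
    SimpleGraph (Fin t ⊕ Fin u) where
  Adj v w := ∃ i j, M i j ≠ 0 ∧
    ((v = Sum.inl i ∧ w = Sum.inr j) ∨ (v = Sum.inr j ∧ w = Sum.inl i))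
  symm := ⟨by
    rintro v w ⟨i, j, h, hvw⟩
    exact ⟨i, j, h, by tauto⟩⟩
  loopless := ⟨by
    rintro v ⟨i, j, -, ⟨h, h'⟩ | ⟨h, h'⟩⟩ <;> simp [h] at h'⟩

open Classical in
/-- `r` is the spectral radius of the finite graph `G`: the largest eigenvalue of its adjacency
matrix (whose entries are `0` and `1`). -/
def IsGraphSpectralRadius {V : Type*} [Fintype V] (G : SimpleGraph V) (r : ℝ) : Prop :=
  IsGreatest {x : ℝ | Module.End.HasEigenvalue (Matrix.toLin' (G.adjMatrix ℝ)) x} r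

/-! A gridded permutation is encoded by two words in the cells: the cells of its points read by
position and by value. Both words have the same content, and they determine the permutation, because
the points of each cell form a monotone sequence of known direction. So counting the class is
counting pairs of words, and bounds sharp up to a polynomial factor in `k` suffice.

Lower bound: let `(x, y)` be an eigenvector of the graph for its largest eigenvalue `r > 0`, and
weight each nonzero cell by `x i * y j / Z`, with `Z` normalizing the total to 1. The marginals are
`r * x i ^ 2 / Z` and `r * y j ^ 2 / Z`, whose product is `r ^ 2` times the squared weight. A
content of polynomially large probability then yields `r ^ (2 * k)` permutations up to a polynomial
factor (`pow_le_mul_ncard_gridClass`).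

Upper bound: for `s > r` there is a positive vector `(x, y)` with `A *ᵥ (x, y) ≤ s • (x, y)`. The
weights `y j / (s * x i)` and `x i / (s * y j)` are substochastic along columns and rows, and their
product is `s⁻²`. Every permutation thus gets weight `s ^ (-2k)`, while for fixed dividers the total
weight is at most 1 (`ncard_gridClass_le`).

Integrality holds because `r` is a root of the monic characteristic polynomial of an integer matrix.
-/

/-! ### Words, their contents, and permutations matching two words -/

/-- The number of occurrences of each letter in a word. -/
def wordContent {X : Type*} [DecidableEq X] {k : ℕ} (g : Fin k → X) (x : X) : Fin (k + 1) :=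
  ⟨Fintype.card {p // g p = x}, by
    simpa [Nat.lt_succ_iff] using Fintype.card_subtype_le (fun p => g p = x)⟩

theorem exists_monotone_fiber_equiv {α β : Type*} [LinearOrder α] [LinearOrder β] [Fintype α]
    [Fintype β] (h : Fintype.card α = Fintype.card β) (s : SignType) :
    ∃ e : α ≃ β, (s = 1 → StrictMono e) ∧ (s = -1 → StrictAnti e) := by
  let a := Fintype.orderIsoFinOfCardEq α h
  let b := Fintype.orderIsoFinOfCardEq β rfl
  by_cases hs : s = 1
  · refine ⟨(a.symm.trans b).toEquiv, fun _ => (a.symm.trans b).strictMono, ?_⟩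
    rintro rfl
    exact absurd hs (by decide)
  · refine ⟨a.symm.toEquiv.trans (Fin.revPerm.trans b.toEquiv), fun h => absurd h hs, fun _ => ?_⟩
    intro x y hxy
    exact b.strictMono (Fin.rev_strictAnti (a.symm.strictMono hxy))

/-- The occurrences of each letter in the two words are matched in increasing or decreasing order
according to `s`, and the bijections are glued. With `s = 0` this is used only to say that words of
equal content are rearrangements of each other. -/
theorem exists_perm_of_wordContent_eq {X : Type*} [DecidableEq X] {k : ℕ} {f h : Fin k → X}
    (hc : wordContent f = wordContent h) (s : X → SignType) :
    ∃ σ : Equiv.Perm (Fin k), (∀ p, h (σ p) = f p) ∧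
      ∀ x, (s x = 1 → StrictMonoOn σ {p | f p = x}) ∧
        (s x = -1 → StrictAntiOn σ {p | f p = x}) := by
  have hcard x : Fintype.card {p // f p = x} = Fintype.card {p // h p = x} := by
    simpa [wordContent] using congrFun hc x
  choose e he using fun x => exists_monotone_fiber_equiv (hcard x) (s x)
  have key p x (hp : f p = x) : Equiv.ofFiberEquiv e p = e x ⟨p, hp⟩ := by
    subst hp; rfl
  refine ⟨Equiv.ofFiberEquiv e, fun p => Equiv.ofFiberEquiv_map e p, fun x => ⟨fun hs => ?_,
    fun hs => ?_⟩⟩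
  · intro p hp q hq hpq
    rw [key p x hp, key q x hq]
    exact (he x).1 hs (show (⟨p, hp⟩ : {p // f p = x}) < ⟨q, hq⟩ from hpq)
  · intro p hp q hq hpq
    rw [key p x hp, key q x hq]
    exact (he x).2 hs (show (⟨p, hp⟩ : {p // f p = x}) < ⟨q, hq⟩ from hpq)

theorem wordContent_comp_perm {X : Type*} [DecidableEq X] {k : ℕ} (f : Fin k → X)
    (π : Equiv.Perm (Fin k)) : wordContent (f ∘ π) = wordContent f := by
  funext x
  refine Fin.ext ?_
  exact Fintype.card_congr (π.subtypeEquiv (p := fun p => f (π p) = x) (q := fun p => f p = x)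
    fun _ => Iff.rfl)

theorem wordContent_comp_left {X Y : Type*} [DecidableEq X] [DecidableEq Y] {k : ℕ}
    {f g : Fin k → X} (h : wordContent f = wordContent g) (φ : X → Y) :
    wordContent (φ ∘ f) = wordContent (φ ∘ g) := by
  obtain ⟨σ, hσ, -⟩ := exists_perm_of_wordContent_eq h 0
  obtain rfl : f = g ∘ σ := funext fun p => (hσ p).symm
  exact wordContent_comp_perm (φ ∘ g) σ

theorem prod_eq_of_wordContent_eq {X R : Type*} [DecidableEq X] [CommMonoid R] {k : ℕ}
    {f g : Fin k → X} (h : wordContent f = wordContent g) (w : X → R) :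
    ∏ p, w (f p) = ∏ p, w (g p) := by
  obtain ⟨σ, hσ, -⟩ := exists_perm_of_wordContent_eq h 0
  simp_rw [← hσ]
  exact Equiv.prod_comp σ fun p => w (g p)

/-- A permutation is determined by its action on the fibers of a word, if on each of them it is
monotone in a given direction. -/
theorem perm_eq_of_monotone_on_fibers {X : Type*} {k : ℕ} {f h : Fin k → X}
    {σ τ : Equiv.Perm (Fin k)} (hσ : ∀ p, h (σ p) = f p) (hτ : ∀ p, h (τ p) = f p)
    (hmono : ∀ x, (StrictMonoOn σ {p | f p = x} ∧ StrictMonoOn τ {p | f p = x}) ∨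
      (StrictAntiOn σ {p | f p = x} ∧ StrictAntiOn τ {p | f p = x})) : σ = τ := by
  have hrange (π : Equiv.Perm (Fin k)) (hπ : ∀ p, h (π p) = f p) x :
      Set.range (fun p : {p | f p = x} => π p) = {q | h q = x} := by
    ext q
    constructor
    · rintro ⟨⟨p, hp⟩, rfl⟩
      exact (hπ p).trans hp
    · intro hq
      exact ⟨⟨π.symm q, by simpa [← hπ] using hq⟩, by simp⟩
  ext1 p
  rcases hmono (f p) with ⟨h₁, h₂⟩ | ⟨h₁, h₂⟩
  · have h₁' : StrictMono (fun q : {q | f q = f p} => σ q) := fun a b hab => h₁ a.2 b.2 hab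
    have h₂' : StrictMono (fun q : {q | f q = f p} => τ q) := fun a b hab => h₂ a.2 b.2 hab
    exact congrFun ((StrictMono.range_inj h₁' h₂').1 ((hrange σ hσ _).trans (hrange τ hτ _).symm))
      ⟨p, rfl⟩
  · have h₁' : StrictMono (fun q : {q | f q = f p} => Fin.rev (σ q)) :=
      fun a b hab => Fin.rev_strictAnti (h₁ a.2 b.2 hab)
    have h₂' : StrictMono (fun q : {q | f q = f p} => Fin.rev (τ q)) :=
      fun a b hab => Fin.rev_strictAnti (h₂ a.2 b.2 hab)
    have := congrArg (Fin.rev '' ·) ((hrange σ hσ (f p)).trans (hrange τ hτ _).symm)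
    simp only [← Set.range_comp] at this
    exact Fin.rev_injective (congrFun ((StrictMono.range_inj h₁' h₂').1 this) ⟨p, rfl⟩)

/-! ### From labelled points to griddings -/

/-- The dividers between the blocks of a monotone map. -/
def dividers {t k : ℕ} (c : Fin k → Fin t) (i : Fin (t + 1)) : ℕ :=
  Fintype.card {p // (c p).castSucc < i}

/-- For monotone `c` the positions counted by `dividers c i` form an initial segment, so their
number is the threshold. -/
theorem lt_dividers_iff {t k : ℕ} {c : Fin k → Fin t} (hc : Monotone c) (i : Fin (t + 1))
    (p : Fin k) : (p : ℕ) < dividers c i ↔ (c p).castSucc < i := by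
  rw [dividers, Fintype.card_subtype]
  constructor
  · intro h
    by_contra hp
    have : (Finset.univ.filter fun q => (c q).castSucc < i) ⊆ Finset.Iio p := by
      intro q hq
      simp only [Finset.mem_filter, Finset.mem_univ, true_and, Finset.mem_Iio] at hq ⊢
      by_contra! hpq
      exact hp (lt_of_le_of_lt (Fin.castSucc_le_castSucc_iff.2 (hc hpq)) hq)
    have := Finset.card_le_card this
    simp at this
    omega
  · intro hp
    have : Finset.Iic p ⊆ (Finset.univ.filter fun q => (c q).castSucc < i) := by
      intro q hq
      simp only [Finset.mem_filter, Finset.mem_univ, true_and, Finset.mem_Iic] at hq ⊢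
      exact lt_of_le_of_lt (Fin.castSucc_le_castSucc_iff.2 (hc hq)) hp
    have := Finset.card_le_card this
    simp at this
    omega

theorem mem_block_iff {t k : ℕ} {c : Fin k → Fin t} (hc : Monotone c) (i : Fin t) (p : Fin k) :
    (dividers c i.castSucc ≤ p ∧ (p : ℕ) < dividers c i.succ) ↔ c p = i := by
  rw [← not_lt, lt_dividers_iff hc, lt_dividers_iff hc, Fin.castSucc_lt_castSucc_iff,
    Fin.castSucc_lt_succ_iff, not_lt, Fin.ext_iff, Fin.le_def, Fin.le_def]
  omega

theorem dividers_mono {t k : ℕ} (c : Fin k → Fin t) : Monotone (dividers c) := fun _ _ hij =>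
  Fintype.card_subtype_mono _ _ fun _ hp => lt_of_lt_of_le hp hij

theorem dividers_zero {t k : ℕ} (c : Fin k → Fin t) : dividers c 0 = 0 := by
  simp [dividers]

theorem dividers_last {t k : ℕ} (c : Fin k → Fin t) : dividers c (Fin.last t) = k := by
  simp [dividers, Fin.castSucc_lt_last]

/-- A monotone labelling of positions by columns and of values by rows which puts every point into
a cell with the right monotonicity gives a gridding. -/
theorem mem_gridClass_of_labels {t u k : ℕ} {M : Matrix (Fin t) (Fin u) SignType}
    {σ : Equiv.Perm (Fin k)} {c : Fin k → Fin t} {d : Fin k → Fin u} (hc : Monotone c)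
    (hd : Monotone d) (hne : ∀ p, M (c p) (d (σ p)) ≠ 0)
    (hinc : ∀ i j, M i j = 1 → StrictMonoOn σ {p | (c p, d (σ p)) = (i, j)})
    (hdec : ∀ i j, M i j = -1 → StrictAntiOn σ {p | (c p, d (σ p)) = (i, j)}) :
    σ ∈ gridClass M k := by
  have hset i j : {p : Fin k | (dividers c i.castSucc ≤ p ∧ p < dividers c i.succ) ∧
      (dividers d j.castSucc ≤ σ p ∧ σ p < dividers d j.succ)} =
      {p | (c p, d (σ p)) = (i, j)} := by
    ext p
    simp only [Set.mem_ofPred_eq, mem_block_iff hc, mem_block_iff hd, Prod.mk.injEq]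
  refine ⟨⟨dividers c, dividers d, dividers_mono c, dividers_zero c, dividers_last c,
    dividers_mono d, dividers_zero d, dividers_last d, ?_, ?_, ?_⟩⟩
  · intro i j h
    rw [hset]
    exact hinc i j h
  · intro i j h
    rw [hset]
    exact hdec i j h
  · intro i j h
    rw [hset, Set.eq_empty_iff_forall_notMem]
    rintro p hp
    obtain ⟨rfl, rfl⟩ := Prod.mk.inj hp
    exact hne p h

/-- Words with the content of `a` and a prescribed sequence of columns, together with words with
the same content and a prescribed sequence of rows, encode different permutations of the class. -/
theorem card_mul_card_le_ncard_gridClass {t u k : ℕ} {M : Matrix (Fin t) (Fin u) SignType}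
    {a : Fin k → Fin t × Fin u} (ha : ∀ p, M (a p).1 (a p).2 ≠ 0) {c : Fin k → Fin t}
    {d : Fin k → Fin u} (hc : Monotone c) (hd : Monotone d) :
    Nat.card {f : Fin k → Fin t × Fin u // wordContent f = wordContent a ∧ Prod.fst ∘ f = c} *
      Nat.card {f : Fin k → Fin t × Fin u // wordContent f = wordContent a ∧ Prod.snd ∘ f = d} ≤
      (gridClass M k).ncard := by
  rw [← Nat.card_prod, ← Nat.card_coe_set_eq]
  -- The first word is read by position and the second by value. Since `c` and `d` are fixed, `τ x`
  -- gives back both words, which yields injectivity.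
  choose τ hτ hτ' using fun x :
    {f : Fin k → Fin t × Fin u // wordContent f = wordContent a ∧ Prod.fst ∘ f = c} ×
    {f : Fin k → Fin t × Fin u // wordContent f = wordContent a ∧ Prod.snd ∘ f = d} =>
      exists_perm_of_wordContent_eq (x.1.2.1.trans x.2.2.1.symm) fun y => M y.1 y.2
  have hf x p : (c p, d (τ x p)) = x.1.1 p := by
    refine Prod.ext (congrFun x.1.2.2 p).symm ?_
    rw [← hτ x p]
    exact (congrFun x.2.2.2 _).symm
  have hM x p : M (c p) (d (τ x p)) ≠ 0 := by
    obtain ⟨π, hπ, -⟩ := exists_perm_of_wordContent_eq x.1.2.1 0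
    have := (hf x p).trans (hπ p).symm
    rw [Prod.ext_iff] at this
    rw [show c p = _ from this.1, show d (τ x p) = _ from this.2]
    exact ha _
  refine Nat.card_le_card_of_injective (fun x => ⟨τ x, mem_gridClass_of_labels hc hd (hM x)
    (fun i j h => ?_) (fun i j h => ?_)⟩) ?_
  · simp_rw [hf]
    exact (hτ' x (i, j)).1 h
  · simp_rw [hf]
    exact (hτ' x (i, j)).2 h
  · intro x y hxy
    have hxy : τ x = τ y := congrArg Subtype.val hxy
    have h₁ : x.1.1 = y.1.1 := funext fun p => by rw [← hf, ← hf, hxy]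
    refine Prod.ext (Subtype.ext h₁) (Subtype.ext (funext fun q => ?_))
    obtain ⟨p, rfl⟩ := (τ x).surjective q
    rw [hτ x p, hxy, hτ y p, h₁]

/-! ### Perron–Frobenius theory for symmetric nonnegative matrices -/

section Perron

open Matrix Module.End

variable {V : Type*} [Fintype V] [DecidableEq V]

theorem hasEigenvalue_toLin'_of_mulVec {A : Matrix V V ℝ} {x : V → ℝ} {r : ℝ} (hx : x ≠ 0)
    (h : A *ᵥ x = r • x) : HasEigenvalue (toLin' A) r :=
  hasEigenvalue_of_hasEigenvector (x := x) (hasEigenvector_iff.2 ⟨mem_eigenspace_iff.2 (by simpa), hx⟩)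

theorem exists_isGreatest_eigenvalue [Nonempty V] {A : Matrix V V ℝ} (hA : A.IsHermitian) :
    ∃ r, IsGreatest {x : ℝ | HasEigenvalue (toLin' A) x} r := by
  have hne : {x : ℝ | HasEigenvalue (toLin' A) x}.Nonempty := by
    obtain ⟨v⟩ := ‹Nonempty V›
    refine ⟨hA.eigenvalues v, hasEigenvalue_toLin'_of_mulVec (x := hA.eigenvectorBasis v) ?_
      (hA.mulVec_eigenvectorBasis v)⟩
    intro h
    exact hA.eigenvectorBasis.toBasis.ne_zero v (by simpa using h)
  obtain ⟨r, hr, hmax⟩ := Set.exists_max_image _ id (finite_hasEigenvalue (toLin' A)) hne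
  exact ⟨r, hr, hmax⟩

theorem posSemidef_smul_one_sub {A : Matrix V V ℝ} (hA : A.IsHermitian) {r : ℝ}
    (hr : r ∈ upperBounds {x : ℝ | HasEigenvalue (toLin' A) x}) :
    (r • (1 : Matrix V V ℝ) - A).PosSemidef := by
  have hB : (r • (1 : Matrix V V ℝ) - A).IsHermitian :=
    (isHermitian_one.smul (IsSelfAdjoint.all r)).sub hA
  rw [hB.posSemidef_iff_eigenvalues_nonneg]
  intro v
  have hv := hB.mulVec_eigenvectorBasis v
  have : HasEigenvalue (toLin' A) (r - hB.eigenvalues v) := by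
    refine hasEigenvalue_toLin'_of_mulVec (x := hB.eigenvectorBasis v) ?_ ?_
    · intro h
      exact hB.eigenvectorBasis.toBasis.ne_zero v (by simpa using h)
    · rw [sub_mulVec, smul_mulVec, one_mulVec] at hv
      rw [sub_smul, ← hv]
      abel
  have := hr this
  simp only [Pi.zero_apply]
  linarith

/-- A weak form of the Perron–Frobenius theorem for symmetric matrices. -/
theorem exists_nonneg_eigenvector {A : Matrix V V ℝ} (hA : A.IsHermitian) (hnn : ∀ v w, 0 ≤ A v w)
    {r : ℝ} (hr : IsGreatest {x : ℝ | HasEigenvalue (toLin' A) x} r) :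
    ∃ z : V → ℝ, (∀ v, 0 ≤ z v) ∧ z ≠ 0 ∧ A *ᵥ z = r • z := by
  obtain ⟨x, hx⟩ := HasEigenvalue.exists_hasEigenvector hr.1
  have hAx : A *ᵥ x = r • x := by simpa using hx.apply_eq_smul
  have hpsd := posSemidef_smul_one_sub hA hr.2
  refine ⟨fun v => |x v|, fun v => abs_nonneg _, fun h => hx.2 ?_, ?_⟩
  · funext v
    simpa using congrFun h v
  -- Passing to absolute values does not increase the quadratic form of the positive semidefinite `r
  -- • 1 - A`. It vanishes at `x`, hence at `|x|`, which therefore lies in the kernel.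
  · have key : (fun v => |x v|) ⬝ᵥ ((r • (1 : Matrix V V ℝ) - A) *ᵥ fun v => |x v|) ≤
        x ⬝ᵥ ((r • (1 : Matrix V V ℝ) - A) *ᵥ x) := by
      rw [sub_mulVec, sub_mulVec, smul_mulVec, smul_mulVec, one_mulVec, one_mulVec,
        dotProduct_sub, dotProduct_sub]
      have h₁ : (fun v => |x v|) ⬝ᵥ (r • fun v => |x v|) = x ⬝ᵥ (r • x) := by
        simp only [dotProduct, Pi.smul_apply, smul_eq_mul]
        refine Finset.sum_congr rfl fun v _ => ?_
        linear_combination r * abs_mul_abs_self (x v)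
      have h₂ : x ⬝ᵥ (A *ᵥ x) ≤ (fun v => |x v|) ⬝ᵥ (A *ᵥ fun v => |x v|) := by
        simp only [dotProduct, mulVec, Finset.mul_sum]
        refine Finset.sum_le_sum fun v _ => Finset.sum_le_sum fun w _ => ?_
        calc x v * (A v w * x w) ≤ |x v * (A v w * x w)| := le_abs_self _
          _ = _ := by rw [abs_mul, abs_mul, abs_of_nonneg (hnn v w)]
      linarith
    have h0 : x ⬝ᵥ ((r • (1 : Matrix V V ℝ) - A) *ᵥ x) = 0 := by
      rw [sub_mulVec, smul_mulVec, one_mulVec, hAx, sub_self, dotProduct_zero]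
    have hzero := (hpsd.dotProduct_mulVec_zero_iff fun v => |x v|).1
      (le_antisymm (key.trans h0.le) (hpsd.dotProduct_mulVec_nonneg _))
    rw [sub_mulVec, smul_mulVec, one_mulVec, sub_eq_zero] at hzero
    exact hzero.symm

/-- Above the largest eigenvalue of a nonnegative symmetric matrix there are strictly positive
subinvariant vectors. -/
theorem exists_pos_subinvariant {A : Matrix V V ℝ} (hA : A.IsHermitian) (hnn : ∀ v w, 0 ≤ A v w)
    {r s : ℝ} (hr : r ∈ upperBounds {x : ℝ | HasEigenvalue (toLin' A) x}) (hr₀ : 0 ≤ r)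
    (hs : r < s) : ∃ x : V → ℝ, (∀ v, 0 < x v) ∧ ∀ v, (A *ᵥ x) v ≤ s * x v := by
  set B := s • (1 : Matrix V V ℝ) - A with hBdef
  have hB : B.PosDef := by
    have : B = (s - r) • (1 : Matrix V V ℝ) + (r • (1 : Matrix V V ℝ) - A) := by
      rw [hBdef, sub_smul]; abel
    rw [this]
    exact (PosDef.one.smul (sub_pos.2 hs)).add_posSemidef (posSemidef_smul_one_sub hA hr)
  have hunit : IsUnit B.det := (isUnit_iff_isUnit_det B).1 hB.isUnit
  set x : V → ℝ := B⁻¹ *ᵥ 1 with hxdef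
  have hx : B *ᵥ x = 1 := by
    rw [hxdef, mulVec_mulVec, mul_nonsing_inv _ hunit, one_mulVec]
  have hoff {v w} (h : v ≠ w) : B v w ≤ 0 := by
    simpa [hBdef, one_apply_ne h] using hnn v w
  -- Pairing `B *ᵥ x = 1` with the negative part `x⁻` gives a nonnegative number. The contribution
  -- of `x⁺` is nonpositive, as `B` has nonpositive off-diagonal entries and `x⁻ * x⁺ = 0`; so `x⁻ ≠
  -- 0` would contradict positive definiteness.
  have hneg : (fun v => (x v)⁻) = 0 := by
    by_contra hne
    have hpos := hB.dotProduct_mulVec_pos hne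
    have h₁ : 0 ≤ (fun v => (x v)⁻) ⬝ᵥ (B *ᵥ x) := by
      rw [hx]
      exact Finset.sum_nonneg fun v _ => by simp [negPart_nonneg]
    have h₂ : (fun v => (x v)⁻) ⬝ᵥ (B *ᵥ fun v => (x v)⁺) ≤ 0 := by
      simp only [dotProduct, mulVec, Finset.mul_sum]
      refine Finset.sum_nonpos fun v _ => Finset.sum_nonpos fun w _ => ?_
      rcases eq_or_ne v w with rfl | h
      · rcases le_total 0 (x v) with h | h
        · simp [negPart_of_nonneg h]
        · simp [posPart_of_nonpos h]
      · exact mul_nonpos_of_nonneg_of_nonpos (negPart_nonneg _)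
          (mul_nonpos_of_nonpos_of_nonneg (hoff h) (posPart_nonneg _))
    have hdec : x = (fun v => (x v)⁺) - fun v => (x v)⁻ := by
      funext v
      simp
    rw [hdec, mulVec_sub, dotProduct_sub, ← hdec] at h₁
    simp only [star_trivial] at hpos
    linarith
  have hx₀ v : 0 ≤ x v := negPart_eq_zero.1 (congrFun hneg v)
  have hAx v : (A *ᵥ x) v = s * x v - 1 := by
    have := congrFun hx v
    rw [hBdef, sub_mulVec, smul_mulVec, one_mulVec] at this
    simp only [Pi.sub_apply, Pi.smul_apply, smul_eq_mul, Pi.one_apply] at this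
    linarith
  refine ⟨x, fun v => ?_, fun v => by rw [hAx]; linarith⟩
  have : 0 ≤ (A *ᵥ x) v := Finset.sum_nonneg fun w _ => mul_nonneg (hnn v w) (hx₀ w)
  rw [hAx] at this
  have h0 : 0 < s := hr₀.trans_lt hs
  by_contra! h
  nlinarith [mul_nonneg h0.le (sub_nonneg.2 h)]

theorem nonneg_of_isGreatest_eigenvalue {A : Matrix V V ℝ} (hA : A.IsHermitian)
    (hnn : ∀ v w, 0 ≤ A v w) {r : ℝ}
    (hr : IsGreatest {x : ℝ | HasEigenvalue (toLin' A) x} r) : 0 ≤ r := by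
  obtain ⟨z, hz, hne, hAz⟩ := exists_nonneg_eigenvector hA hnn hr
  obtain ⟨v, hv⟩ := Function.ne_iff.1 hne
  have hv' : 0 < z v := (hz v).lt_of_ne' hv
  have : 0 ≤ (A *ᵥ z) v := Finset.sum_nonneg fun w _ => mul_nonneg (hnn v w) (hz w)
  rw [hAz] at this
  exact nonneg_of_mul_nonneg_left this hv'

theorem isIntegral_of_hasEigenvalue_map_intCast {B : Matrix V V ℤ} {r : ℝ}
    (h : HasEigenvalue (toLin' (B.map (Int.cast : ℤ → ℝ))) r) : IsIntegral ℤ r := by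
  rw [hasEigenvalue_iff_isRoot_charpoly, charpoly_toLin'] at h
  refine ⟨B.charpoly, B.charpoly_monic, ?_⟩
  have := charpoly_map B (Int.castRingHom ℝ)
  rw [show B.map (Int.cast : ℤ → ℝ) = B.map (Int.castRingHom ℝ) from rfl, this] at h
  rwa [Polynomial.IsRoot, Polynomial.eval_map] at h

end Perron

/-! ### Counting words of a given content -/

section WordCounting

variable {X Y : Type*} [Fintype X] [DecidableEq X] [Fintype Y] [DecidableEq Y] {k : ℕ}

/-- All words with the content of `a` have images of the same weight. Those images are
rearrangements of `c`, so by symmetry each has as many preimages as `c`; the total weight of words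
over `Y` is at most 1. -/
theorem card_wordContent_fiber_mul_le (a : Fin k → X) (φ : X → Y) (c : Fin k → Y)
    (hc : wordContent c = wordContent (φ ∘ a)) (w : Y → ℝ) (hw : ∀ y, 0 ≤ w y)
    (hsum : ∑ y, w y ≤ 1) :
    (Nat.card {f : Fin k → X // wordContent f = wordContent a} : ℝ) * ∏ p, w (φ (a p)) ≤
      Nat.card {f : Fin k → X // wordContent f = wordContent a ∧ φ ∘ f = c} := by
  classical
  set S := Finset.univ.filter fun f : Fin k → X => wordContent f = wordContent a
  set N := Nat.card {f : Fin k → X // wordContent f = wordContent a ∧ φ ∘ f = c}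
  have hcard (d : Fin k → Y) : ((S.filter fun f => φ ∘ f = d).card : ℝ) * ∏ p, w (d p) ≤
      N * ∏ p, w (d p) := by
    refine mul_le_mul_of_nonneg_right ?_ (Finset.prod_nonneg fun _ _ => hw _)
    rcases (S.filter fun f => φ ∘ f = d).eq_empty_or_nonempty with h | ⟨f, hf⟩
    · simp [h]
    · simp only [S, Finset.mem_filter, Finset.mem_univ, true_and] at hf
      have hd : wordContent c = wordContent d := by
        rw [hc, ← hf.2]
        exact wordContent_comp_left hf.1.symm φ
      obtain ⟨π, hπ, -⟩ := exists_perm_of_wordContent_eq hd 0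
      obtain rfl : d ∘ π = c := funext hπ
      rw [Nat.cast_le, Finset.filter_filter, ← Fintype.card_subtype, ← Nat.card_eq_fintype_card]
      refine Nat.card_le_card_of_injective
        (fun f => ⟨f.1 ∘ π, (wordContent_comp_perm _ _).trans f.2.1, ?_⟩) ?_
      · rw [← Function.comp_assoc, f.2.2]
      · intro f g hfg
        exact Subtype.ext (π.surjective.injective_comp_right (congrArg Subtype.val hfg))
  have htot : ∑ d : Fin k → Y, ∏ p, w (d p) ≤ 1 := by
    rw [← Fintype.piFinset_univ, ← Finset.prod_univ_sum, Finset.prod_const]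
    exact pow_le_one₀ (Finset.sum_nonneg fun y _ => hw y) hsum
  calc (Nat.card {f : Fin k → X // wordContent f = wordContent a} : ℝ) * ∏ p, w (φ (a p))
      = ∑ f ∈ S, ∏ p, w (φ (f p)) := by
        rw [Nat.card_eq_fintype_card, Fintype.card_subtype, ← nsmul_eq_mul, ← Finset.sum_const]
        refine Finset.sum_congr rfl fun f hf => ?_
        exact (prod_eq_of_wordContent_eq (Finset.mem_filter.1 hf).2 fun x => w (φ x)).symm
    _ = ∑ d : Fin k → Y, ∑ f ∈ S with φ ∘ f = d, ∏ p, w (φ (f p)) :=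
        (Finset.sum_fiberwise S (fun f => φ ∘ f) _).symm
    _ = ∑ d : Fin k → Y, ((S.filter fun f => φ ∘ f = d).card : ℝ) * ∏ p, w (d p) := by
        refine Finset.sum_congr rfl fun d _ => ?_
        rw [← nsmul_eq_mul, ← Finset.sum_const]
        refine Finset.sum_congr rfl fun f hf => ?_
        rw [← (Finset.mem_filter.1 hf).2]
        rfl
    _ ≤ ∑ d : Fin k → Y, N * ∏ p, w (d p) := Finset.sum_le_sum fun d _ => hcard d
    _ ≤ N := by
        rw [← Finset.mul_sum]
        exact mul_le_of_le_one_right (Nat.cast_nonneg _) htot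

/-- Under a product measure, some content is taken with at least polynomially small probability. -/
theorem exists_likely_wordContent (k : ℕ) (w : X → ℝ) (hsum : ∑ x, w x = 1) :
    ∃ a : Fin k → X, 1 ≤ ((k : ℝ) + 1) ^ Fintype.card X *
      (Nat.card {f : Fin k → X // wordContent f = wordContent a} * ∏ p, w (a p)) := by
  classical
  have htot : ∑ f : Fin k → X, ∏ p, w (f p) = 1 := by
    rw [← Fintype.piFinset_univ, ← Finset.prod_univ_sum, Finset.prod_const, hsum, one_pow]
  rw [← Finset.sum_fiberwise _ (wordContent : (Fin k → X) → _)] at htot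
  -- Pigeonhole: total weight 1 is spread over `(k + 1) ^ card X` candidate contents.
  obtain ⟨b, -, hb⟩ := Finset.exists_le_of_sum_le (s := Finset.univ)
    (f := fun _ : X → Fin (k + 1) => 1 / ((k : ℝ) + 1) ^ Fintype.card X) Finset.univ_nonempty
    (le_of_eq (by
      rw [htot, Finset.sum_const, Finset.card_univ, Fintype.card_fun, Fintype.card_fin]
      have : ((k : ℝ) + 1) ^ Fintype.card X ≠ 0 := by positivity
      simp [this]))
  rw [div_le_iff₀' (by positivity)] at hb
  rcases (Finset.univ.filter fun f : Fin k → X => wordContent f = b).eq_empty_or_nonempty with h | ⟨a, ha⟩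
  · rw [h] at hb
    norm_num at hb
  · obtain rfl := (Finset.mem_filter.1 ha).2
    refine ⟨a, hb.trans_eq ?_⟩
    rw [Nat.card_eq_fintype_card, Fintype.card_subtype, ← nsmul_eq_mul, ← Finset.sum_const]
    congr 1
    exact Finset.sum_congr rfl fun f hf => prod_eq_of_wordContent_eq (Finset.mem_filter.1 hf).2 w

end WordCounting

/-! ### Lower bound from an eigenvector -/

section Bounds

variable {t u : ℕ}

open Classical in
-- No signs are required of `x` and `y`: the total `Z` and the marginals involve only squares, and
-- the likely-content estimate is squared at the end.
theorem pow_le_mul_ncard_gridClass (M : Matrix (Fin t) (Fin u) SignType) {x : Fin t → ℝ}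
    {y : Fin u → ℝ} {r : ℝ} (hr : 0 < r)
    (hne : (∃ i, x i ≠ 0) ∨ ∃ j, y j ≠ 0)
    (hcol : ∀ i, ∑ j, (if M i j ≠ 0 then y j else 0) = r * x i)
    (hrow : ∀ j, ∑ i, (if M i j ≠ 0 then x i else 0) = r * y j) (k : ℕ) :
    r ^ (2 * k) ≤ ((k : ℝ) + 1) ^ (t * u * 2) * (gridClass M k).ncard := by
  set v : Fin t × Fin u → ℝ := fun z => if M z.1 z.2 ≠ 0 then x z.1 * y z.2 else 0 with hv
  have hvcol i : ∑ j, v (i, j) = r * x i ^ 2 := by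
    have : ∀ j, v (i, j) = x i * (if M i j ≠ 0 then y j else 0) := fun j => by
      simp only [hv, mul_ite, mul_zero]
    rw [Finset.sum_congr rfl fun j _ => this j, ← Finset.mul_sum, hcol]
    ring
  have hvrow j : ∑ i, v (i, j) = r * y j ^ 2 := by
    have : ∀ i, v (i, j) = y j * (if M i j ≠ 0 then x i else 0) := fun i => by
      simp only [hv, mul_ite, mul_zero, mul_comm (x i)]
    rw [Finset.sum_congr rfl fun i _ => this i, ← Finset.mul_sum, hrow]
    ring
  set Z : ℝ := ∑ z, v z with hZ
  have hZcol : Z = r * ∑ i, x i ^ 2 := by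
    rw [hZ, Fintype.sum_prod_type, Finset.sum_congr rfl fun i _ => hvcol i, Finset.mul_sum]
  have hZrow : Z = r * ∑ j, y j ^ 2 := by
    rw [hZ, Fintype.sum_prod_type_right, Finset.sum_congr rfl fun j _ => hvrow j, Finset.mul_sum]
  have hZpos : 0 < Z := by
    rcases hne with ⟨i, hi⟩ | ⟨j, hj⟩
    · rw [hZcol]
      exact mul_pos hr (Finset.sum_pos' (fun i _ => sq_nonneg _) ⟨i, Finset.mem_univ i, by positivity⟩)
    · rw [hZrow]
      exact mul_pos hr (Finset.sum_pos' (fun i _ => sq_nonneg _) ⟨j, Finset.mem_univ j, by positivity⟩)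
  obtain ⟨a, ha⟩ := exists_likely_wordContent k (fun z => v z / Z)
    (by rw [← Finset.sum_div]; exact div_self hZpos.ne')
  rw [Fintype.card_prod, Fintype.card_fin, Fintype.card_fin] at ha
  set S : ℝ := (Nat.card {f : Fin k → Fin t × Fin u // wordContent f = wordContent a} : ℝ)
  have hprod : ∏ p, v (a p) / Z ≠ 0 := by
    intro h
    rw [h] at ha
    norm_num at ha
  have hedge p : M (a p).1 (a p).2 ≠ 0 := by
    intro h
    exact hprod (Finset.prod_eq_zero (Finset.mem_univ p) (by simp [hv, h]))
  -- Sorting the columns of `a` gives the monotone column sequence; its weights are the column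
  -- marginals of `v / Z`.
  have hcol' := card_wordContent_fiber_mul_le a Prod.fst
    ((Prod.fst ∘ a) ∘ Tuple.sort (Prod.fst ∘ a)) (wordContent_comp_perm _ _)
    (fun i => r * x i ^ 2 / Z) (fun i => by positivity)
    (by rw [← Finset.sum_div, ← Finset.mul_sum, ← hZcol, div_self hZpos.ne'])
  have hrow' := card_wordContent_fiber_mul_le a Prod.snd
    ((Prod.snd ∘ a) ∘ Tuple.sort (Prod.snd ∘ a)) (wordContent_comp_perm _ _)
    (fun j => r * y j ^ 2 / Z) (fun j => by positivity)
    (by rw [← Finset.sum_div, ← Finset.mul_sum, ← hZrow, div_self hZpos.ne'])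
  have hN := card_mul_card_le_ncard_gridClass hedge
    (Tuple.monotone_sort (Prod.fst ∘ a)) (Tuple.monotone_sort (Prod.snd ∘ a))
  have hN' := (mul_le_mul hcol' hrow' (mul_nonneg (Nat.cast_nonneg _)
    (Finset.prod_nonneg fun _ _ => by positivity)) (Nat.cast_nonneg _)).trans
    (by exact_mod_cast hN : _ ≤ ((gridClass M k).ncard : ℝ))
  have hcombine : (∏ p, r * x (a p).1 ^ 2 / Z) * ∏ p, r * y (a p).2 ^ 2 / Z =
      r ^ (2 * k) * (∏ p, v (a p) / Z) ^ 2 := by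
    have : r ^ (2 * k) = ∏ _p : Fin k, r ^ 2 := by simp [pow_mul]
    rw [this, ← Finset.prod_pow, ← Finset.prod_mul_distrib, ← Finset.prod_mul_distrib]
    refine Finset.prod_congr rfl fun p _ => ?_
    simp only [hv, hedge p, ne_eq, not_false_eq_true, if_true]
    ring
  have hsq : 1 ≤ (((k : ℝ) + 1) ^ (t * u) * (S * ∏ p, v (a p) / Z)) ^ 2 := one_le_pow₀ ha
  calc r ^ (2 * k) ≤ r ^ (2 * k) * (((k : ℝ) + 1) ^ (t * u) * (S * ∏ p, v (a p) / Z)) ^ 2 :=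
        le_mul_of_one_le_right (by positivity) hsq
    _ = ((k : ℝ) + 1) ^ (t * u * 2) * ((S * ∏ p, r * x (a p).1 ^ 2 / Z) *
          (S * ∏ p, r * y (a p).2 ^ 2 / Z)) := by
        rw [mul_mul_mul_comm S, hcombine, pow_mul]
        ring
    _ ≤ _ := mul_le_mul_of_nonneg_left hN' (by positivity)

/-! ### Cells of a gridding and the upper bound -/

theorem exists_block {n k : ℕ} {d : Fin (n + 1) → ℕ} (h0 : d 0 = 0) (hlast : d (Fin.last n) = k)
    {p : ℕ} (hp : p < k) : ∃ i : Fin n, d i.castSucc ≤ p ∧ p < d i.succ := by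
  by_contra! h
  have : ∀ i, d i ≤ p := fun i => by
    induction i using Fin.induction with
    | zero => omega
    | succ i ih => exact h i ih
  have := this (Fin.last n)
  omega

/-- The block between consecutive dividers that contains `p`. -/
noncomputable def blockIndex {n : ℕ} [Nonempty (Fin n)] (d : Fin (n + 1) → ℕ) (p : ℕ) : Fin n :=
  Classical.epsilon fun i => d i.castSucc ≤ p ∧ p < d i.succ

theorem blockIndex_spec {n k : ℕ} [Nonempty (Fin n)] {d : Fin (n + 1) → ℕ} (h0 : d 0 = 0)
    (hlast : d (Fin.last n) = k) (p : Fin k) :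
    d (blockIndex d p).castSucc ≤ p ∧ (p : ℕ) < d (blockIndex d p).succ :=
  Classical.epsilon_spec (p := fun i : Fin n => d i.castSucc ≤ p ∧ p < d i.succ)
    (exists_block h0 hlast p.2)

theorem blockIndex_eq_iff {n k : ℕ} [Nonempty (Fin n)] {d : Fin (n + 1) → ℕ} (h0 : d 0 = 0)
    (hlast : d (Fin.last n) = k) (hd : Monotone d) (p : Fin k) (i : Fin n) :
    blockIndex d p = i ↔ d i.castSucc ≤ p ∧ (p : ℕ) < d i.succ := by
  have hs := blockIndex_spec h0 hlast p
  constructor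
  · rintro rfl
    exact hs
  · intro hi
    by_contra hne
    rcases lt_or_gt_of_ne hne with h | h
    · have := hd (Fin.succ_le_castSucc_iff.2 h)
      omega
    · have := hd (Fin.succ_le_castSucc_iff.2 h)
      omega

namespace Gridding

variable {k : ℕ} {M : Matrix (Fin t) (Fin u) SignType} {σ : Equiv.Perm (Fin k)}
  [Nonempty (Fin t)] [Nonempty (Fin u)]

/-- The cell containing the point of `σ` at a given position. -/
noncomputable def cell (G : Gridding M σ) (p : Fin k) : Fin t × Fin u :=
  (blockIndex G.col p, blockIndex G.row (σ p))

theorem setOf_cell_eq (G : Gridding M σ) (i : Fin t) (j : Fin u) :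
    {p | G.cell p = (i, j)} = {p : Fin k | (G.col i.castSucc ≤ p ∧ p < G.col i.succ) ∧
      (G.row j.castSucc ≤ σ p ∧ σ p < G.row j.succ)} := by
  ext p
  simp only [cell, Set.mem_ofPred_eq, Prod.mk.injEq,
    blockIndex_eq_iff G.col_zero G.col_last G.col_mono,
    blockIndex_eq_iff G.row_zero G.row_last G.row_mono]

theorem cell_ne_zero (G : Gridding M σ) (p : Fin k) : M (G.cell p).1 (G.cell p).2 ≠ 0 := by
  intro h
  have : p ∈ {q | G.cell q = ((G.cell p).1, (G.cell p).2)} := rfl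
  rw [setOf_cell_eq, G.empty _ _ h] at this
  exact this

theorem perm_eq {τ : Equiv.Perm (Fin k)} (G : Gridding M σ) (H : Gridding M τ)
    (h : G.cell = H.cell) (h' : G.cell ∘ σ.symm = H.cell ∘ τ.symm) : σ = τ := by
  refine perm_eq_of_monotone_on_fibers (f := G.cell) (h := G.cell ∘ σ.symm) (fun p => by simp)
    (fun p => by rw [h', h]; simp) ?_
  rintro ⟨i, j⟩
  have hH := H.setOf_cell_eq i j
  rw [← h] at hH
  rcases hM : M i j with _ | _ | _
  · have hempty : {p | G.cell p = (i, j)} = ∅ := (G.setOf_cell_eq i j).trans (G.empty i j hM)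
    rw [hempty]
    exact Or.inl ⟨fun _ h => h.elim, fun _ h => h.elim⟩
  · refine Or.inr ⟨?_, ?_⟩
    · rw [G.setOf_cell_eq]
      exact G.decreasing i j hM
    · rw [hH]
      exact H.decreasing i j hM
  · refine Or.inl ⟨?_, ?_⟩
    · rw [G.setOf_cell_eq]
      exact G.increasing i j hM
    · rw [hH]
      exact H.increasing i j hM

end Gridding

open Classical in
theorem ncard_gridClass_le [Nonempty (Fin t)] [Nonempty (Fin u)]
    (M : Matrix (Fin t) (Fin u) SignType) {x : Fin t → ℝ}
    {y : Fin u → ℝ} {s : ℝ} (hs : 0 < s) (hx : ∀ i, 0 < x i) (hy : ∀ j, 0 < y j)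
    (hcol : ∀ i, ∑ j, (if M i j ≠ 0 then y j else 0) ≤ s * x i)
    (hrow : ∀ j, ∑ i, (if M i j ≠ 0 then x i else 0) ≤ s * y j) (k : ℕ) :
    ((gridClass M k).ncard : ℝ) ≤ ((k : ℝ) + 1) ^ (t + 1 + (u + 1)) * s ^ (2 * k) := by
  set v : Fin t → Fin u → ℝ := fun i j => if M i j ≠ 0 then y j / (s * x i) else 0 with hv
  set w : Fin t → Fin u → ℝ := fun i j => if M i j ≠ 0 then x i / (s * y j) else 0 with hw
  have hv₀ i j : 0 ≤ v i j := by
    have := hx i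
    have := hy j
    simp only [hv]
    positivity
  have hw₀ i j : 0 ≤ w i j := by
    have := hx i
    have := hy j
    simp only [hw]
    positivity
  have hvsum i : ∑ j, v i j ≤ 1 := by
    have h : ∀ j, v i j = (if M i j ≠ 0 then y j else 0) / (s * x i) := fun j => by
      simp only [hv, ite_div, zero_div]
    rw [Finset.sum_congr rfl fun j _ => h j, ← Finset.sum_div]
    exact div_le_one_of_le₀ (hcol i) (mul_pos hs (hx i)).le
  have hwsum j : ∑ i, w i j ≤ 1 := by
    have h : ∀ i, w i j = (if M i j ≠ 0 then x i else 0) / (s * y j) := fun i => by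
      simp only [hw, ite_div, zero_div]
    rw [Finset.sum_congr rfl fun j _ => h j, ← Finset.sum_div]
    exact div_le_one_of_le₀ (hrow j) (mul_pos hs (hy j)).le
  have hvw i j (h : M i j ≠ 0) : v i j * w i j = (s ^ 2)⁻¹ := by
    have := (hx i).ne'
    have := (hy j).ne'
    simp only [hv, hw, h, ne_eq, not_false_eq_true, if_true]
    field_simp
  -- One gridding per permutation is enough: only the injectivity of the encoding matters.
  let G (σ : gridClass M k) : Gridding M σ.1 := σ.2.some
  have hcolk (σ) i : (G σ).col i < k + 1 := by
    have := (G σ).col_mono (Fin.le_last i)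
    rw [(G σ).col_last] at this
    omega
  have hrowk (σ) i : (G σ).row i < k + 1 := by
    have := (G σ).row_mono (Fin.le_last i)
    rw [(G σ).row_last] at this
    omega
  let D := (Fin (t + 1) → Fin (k + 1)) × (Fin (u + 1) → Fin (k + 1))
  let Φ : gridClass M k → D × ((Fin k → Fin u) × (Fin k → Fin t)) := fun σ =>
    ((fun i => ⟨_, hcolk σ i⟩, fun i => ⟨_, hrowk σ i⟩),
      (fun p => ((G σ).cell p).2, fun q => ((G σ).cell (σ.1.symm q)).1))
  -- The dividers give the column of each position and the row of each value, so only the row of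
  -- each position and the column of each value are weighted, conditionally on these.
  let W : D × ((Fin k → Fin u) × (Fin k → Fin t)) → ℝ := fun e =>
    (∏ p : Fin k, v (blockIndex (fun i => (e.1.1 i : ℕ)) p) (e.2.1 p)) *
      ∏ q : Fin k, w (e.2.2 q) (blockIndex (fun i => (e.1.2 i : ℕ)) q)
  have hW₀ e : 0 ≤ W e :=
    mul_nonneg (Finset.prod_nonneg fun _ _ => hv₀ _ _) (Finset.prod_nonneg fun _ _ => hw₀ _ _)
  have hΦ : Function.Injective Φ := by
    intro σ τ h
    obtain ⟨h₁, h₂⟩ := Prod.mk.inj h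
    obtain ⟨hc, hr⟩ := Prod.mk.inj h₁
    obtain ⟨hf, hg⟩ := Prod.mk.inj h₂
    have hc' : (G σ).col = (G τ).col := funext fun i => congrArg Fin.val (congrFun hc i)
    have hr' : (G σ).row = (G τ).row := funext fun i => congrArg Fin.val (congrFun hr i)
    refine Subtype.ext ((G σ).perm_eq (G τ) (funext fun p => Prod.ext ?_ (congrFun hf p))
      (funext fun q => Prod.ext (congrFun hg q) ?_))
    · simp only [Gridding.cell, hc']
    · simp only [Gridding.cell, hr', Function.comp_apply, Equiv.apply_symm_apply]
  have hWΦ σ : W (Φ σ) = (s ^ (2 * k))⁻¹ := by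
    have h₁ : ∏ q : Fin k, w ((G σ).cell (σ.1.symm q)).1 (blockIndex (G σ).row q) =
        ∏ p : Fin k, w ((G σ).cell p).1 ((G σ).cell p).2 := by
      rw [← Equiv.prod_comp σ.1]
      simp only [Equiv.symm_apply_apply, Gridding.cell]
    calc W (Φ σ) = (∏ p : Fin k, v ((G σ).cell p).1 ((G σ).cell p).2) *
          ∏ q : Fin k, w ((G σ).cell (σ.1.symm q)).1 (blockIndex (G σ).row q) := rfl
      _ = ∏ p : Fin k, (s ^ 2)⁻¹ := by
          rw [h₁, ← Finset.prod_mul_distrib]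
          exact Finset.prod_congr rfl fun p _ => hvw _ _ ((G σ).cell_ne_zero p)
      _ = _ := by simp [pow_mul]
  have hinner (d : D) : ∑ e, W (d, e) ≤ 1 := by
    simp only [W]
    rw [Fintype.sum_prod_type]
    dsimp only
    rw [← Finset.sum_mul_sum]
    refine mul_le_one₀ ?_ (Finset.sum_nonneg fun _ _ => Finset.prod_nonneg fun _ _ => hw₀ _ _) ?_
    · rw [← Fintype.piFinset_univ, ← Finset.prod_univ_sum (fun _ : Fin k => Finset.univ)
        (fun (p : Fin k) j => v (blockIndex (fun i => (d.1 i : ℕ)) p) j)]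
      exact Finset.prod_le_one (fun _ _ => Finset.sum_nonneg fun _ _ => hv₀ _ _) fun _ _ => hvsum _
    · rw [← Fintype.piFinset_univ, ← Finset.prod_univ_sum (fun _ : Fin k => Finset.univ)
        (fun (q : Fin k) i => w i (blockIndex (fun l => (d.2 l : ℕ)) q))]
      exact Finset.prod_le_one (fun _ _ => Finset.sum_nonneg fun _ _ => hw₀ _ _) fun _ _ => hwsum _
  have htotal : ((gridClass M k).ncard : ℝ) * (s ^ (2 * k))⁻¹ ≤
      ((k : ℝ) + 1) ^ (t + 1 + (u + 1)) := by
    calc ((gridClass M k).ncard : ℝ) * (s ^ (2 * k))⁻¹ = ∑ σ : gridClass M k, W (Φ σ) := by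
          rw [Finset.sum_congr rfl fun σ _ => hWΦ σ, Finset.sum_const, nsmul_eq_mul,
            Finset.card_univ, ← Nat.card_eq_fintype_card, Nat.card_coe_set_eq]
      _ = ∑ e ∈ Finset.univ.map ⟨Φ, hΦ⟩, W e := by simp
      _ ≤ ∑ e, W e := Finset.sum_le_sum_of_subset_of_nonneg (Finset.subset_univ _)
          fun _ _ _ => hW₀ _
      _ = ∑ d, ∑ e, W (d, e) := Fintype.sum_prod_type _
      _ ≤ ∑ _d : D, 1 := Finset.sum_le_sum fun d _ => hinner d
      _ = _ := by simp [D, pow_add]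
  rwa [← div_eq_mul_inv, div_le_iff₀ (by positivity)] at htotal

end Bounds

/-! ### From polynomially tight bounds to the growth rate -/

/-- Exponential bounds up to polynomial factors determine the growth rate. -/
theorem tendsto_rpow_of_polynomial_bounds {N : ℕ → ℝ} {r : ℝ} (hr : 0 ≤ r) (hN : ∀ k, 0 ≤ N k)
    (a b : ℕ) (hlow : ∀ k : ℕ, k ≠ 0 → r ^ (2 * k) ≤ ((k : ℝ) + 1) ^ a * N k)
    (hup : ∀ s, r < s → ∀ k, N k ≤ ((k : ℝ) + 1) ^ b * s ^ (2 * k)) :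
    Tendsto (fun k : ℕ => N k ^ (1 / (k : ℝ))) atTop (𝓝 (r ^ 2)) := by
  have hpoly (c : ℕ) : Tendsto (fun k : ℕ => (((k : ℝ) + 1) ^ c) ^ (1 / (k : ℝ))) atTop (𝓝 1) := by
    -- Evaluated at `k + 1`, the exponent `c / (1 * (k + 1) - 1)` is `c / k`.
    have h := (tendsto_rpow_div_mul_add (c : ℝ) 1 (-1) zero_ne_one).comp
      (tendsto_atTop_add_const_right atTop (1 : ℝ) tendsto_natCast_atTop_atTop)
    refine h.congr fun k => ?_
    have : (0 : ℝ) ≤ (k : ℝ) + 1 := by positivity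
    simp only [Function.comp_apply]
    rw [← Real.rpow_natCast, ← Real.rpow_mul this]
    ring_nf
  have hroot {s : ℝ} (hs : 0 ≤ s) {k : ℕ} (hk : k ≠ 0) : (s ^ (2 * k)) ^ (1 / (k : ℝ)) = s ^ 2 := by
    rw [pow_mul, one_div, Real.pow_rpow_inv_natCast (by positivity) hk]
  rw [tendsto_order]
  constructor
  · intro c hc
    have hlim : Tendsto (fun k : ℕ => r ^ 2 / (((k : ℝ) + 1) ^ a) ^ (1 / (k : ℝ))) atTop
        (𝓝 (r ^ 2)) := by
      have h := Tendsto.div (tendsto_const_nhds (x := r ^ 2)) (hpoly a) one_ne_zero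
      rw [div_one] at h
      exact h
    filter_upwards [hlim.eventually_const_lt hc, eventually_ne_atTop 0] with k hk hk0
    refine hk.trans_le ?_
    rw [div_le_iff₀' (by positivity), ← hroot hr hk0, ← Real.mul_rpow (by positivity) (hN k)]
    exact Real.rpow_le_rpow (by positivity) (hlow k hk0) (by positivity)
  · intro c hc
    have hc0 : 0 < c := (sq_nonneg r).trans_lt hc
    obtain ⟨s, hrs, hsc⟩ := exists_between (Real.lt_sqrt_of_sq_lt hc)
    have hs : 0 < s := hr.trans_lt hrs
    have hsc' : s ^ 2 < c := (Real.lt_sqrt hs.le).1 hsc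
    have hlim : Tendsto (fun k : ℕ => (((k : ℝ) + 1) ^ b) ^ (1 / (k : ℝ)) * s ^ 2) atTop
        (𝓝 (s ^ 2)) := by
      simpa using (hpoly b).mul_const (s ^ 2)
    filter_upwards [hlim.eventually_lt_const hsc', eventually_ne_atTop 0] with k hk hk0
    refine lt_of_le_of_lt ?_ hk
    rw [← hroot hs.le hk0, ← Real.mul_rpow (by positivity) (by positivity)]
    exact Real.rpow_le_rpow (hN k) (hup s hrs k) (by positivity)

/-! ### The adjacency matrix of the row-column graph and the conclusion -/

theorem rowColumnGraph_adj_inl_inl {t u : ℕ} (M : Matrix (Fin t) (Fin u) SignType) (i i' : Fin t) :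
    ¬(rowColumnGraph M).Adj (Sum.inl i) (Sum.inl i') := by
  simp [rowColumnGraph]

theorem rowColumnGraph_adj_inr_inr {t u : ℕ} (M : Matrix (Fin t) (Fin u) SignType) (j j' : Fin u) :
    ¬(rowColumnGraph M).Adj (Sum.inr j) (Sum.inr j') := by
  simp [rowColumnGraph]

theorem rowColumnGraph_adj_inl_inr {t u : ℕ} (M : Matrix (Fin t) (Fin u) SignType) (i : Fin t)
    (j : Fin u) : (rowColumnGraph M).Adj (Sum.inl i) (Sum.inr j) ↔ M i j ≠ 0 := by
  simp [rowColumnGraph]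

theorem rowColumnGraph_adj_inr_inl {t u : ℕ} (M : Matrix (Fin t) (Fin u) SignType) (i : Fin t)
    (j : Fin u) : (rowColumnGraph M).Adj (Sum.inr j) (Sum.inl i) ↔ M i j ≠ 0 := by
  simp [rowColumnGraph]

open Classical in
theorem adjMatrix_rowColumnGraph_mulVec_inl {t u : ℕ} (M : Matrix (Fin t) (Fin u) SignType)
    (z : Fin t ⊕ Fin u → ℝ) (i : Fin t) :
    ((rowColumnGraph M).adjMatrix ℝ).mulVec z (Sum.inl i) =
      ∑ j, if M i j ≠ 0 then z (Sum.inr j) else 0 := by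
  simp [Matrix.mulVec, dotProduct, rowColumnGraph_adj_inl_inl, rowColumnGraph_adj_inl_inr]

open Classical in
theorem adjMatrix_rowColumnGraph_mulVec_inr {t u : ℕ} (M : Matrix (Fin t) (Fin u) SignType)
    (z : Fin t ⊕ Fin u → ℝ) (j : Fin u) :
    ((rowColumnGraph M).adjMatrix ℝ).mulVec z (Sum.inr j) =
      ∑ i, if M i j ≠ 0 then z (Sum.inl i) else 0 := by
  simp [Matrix.mulVec, dotProduct, rowColumnGraph_adj_inr_inr,
    rowColumnGraph_adj_inr_inl]

theorem mainTheorem5 (t u : ℕ) (ht : 0 < t) (hu : 0 < u) (M : Matrix (Fin t) (Fin u) SignType) :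
    ∃ g : ℝ, HasGrowthRate (gridClass M) g ∧
      IsIntegral ℤ g ∧
      ∃ r : ℝ, IsGraphSpectralRadius (rowColumnGraph M) r ∧ g = r ^ 2 := by
  classical
  have : Nonempty (Fin t) := ⟨⟨0, ht⟩⟩
  have : Nonempty (Fin u) := ⟨⟨0, hu⟩⟩
  set A := (rowColumnGraph M).adjMatrix ℝ with hAdef
  have hA : A.IsHermitian := by
    rw [Matrix.IsHermitian, Matrix.conjTranspose_eq_transpose_of_trivial]
    exact (rowColumnGraph M).isSymm_adjMatrix
  have hnn v w : 0 ≤ A v w := by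
    rw [hAdef, SimpleGraph.adjMatrix_apply]
    positivity
  obtain ⟨r, hr⟩ := exists_isGreatest_eigenvalue hA
  have hr₀ := nonneg_of_isGreatest_eigenvalue hA hnn hr
  obtain ⟨z, -, hzne, hAz⟩ := exists_nonneg_eigenvector hA hnn hr
  have hint : IsIntegral ℤ r := by
    refine isIntegral_of_hasEigenvalue_map_intCast (B := (rowColumnGraph M).adjMatrix ℤ) ?_
    convert hr.1
    ext v w
    simp [hAdef, SimpleGraph.adjMatrix_apply]
  refine ⟨r ^ 2, tendsto_rpow_of_polynomial_bounds hr₀ (fun k => Nat.cast_nonneg _) (t * u * 2)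
    (t + 1 + (u + 1)) (fun k hk => ?_) (fun s hs k => ?_), hint.pow 2, r, ?_, rfl⟩
  -- If `r = 0` the lower bound is trivial, but only for `k ≠ 0`, since `0 ^ 0 = 1`.
  · rcases hr₀.eq_or_lt with rfl | hpos
    · rw [zero_pow (by omega)]
      positivity
    · refine pow_le_mul_ncard_gridClass M (x := fun i => z (Sum.inl i))
        (y := fun j => z (Sum.inr j)) hpos ?_ (fun i => ?_)
        (fun j => ?_) k
      · obtain ⟨v, hv⟩ := Function.ne_iff.1 hzne
        rcases v with i | j
        · exact Or.inl ⟨i, hv⟩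
        · exact Or.inr ⟨j, hv⟩
      · have h := congrFun hAz (Sum.inl i)
        rw [hAdef, adjMatrix_rowColumnGraph_mulVec_inl] at h
        exact h
      · have h := congrFun hAz (Sum.inr j)
        rw [hAdef, adjMatrix_rowColumnGraph_mulVec_inr] at h
        exact h
  · obtain ⟨x, hx, hAx⟩ := exists_pos_subinvariant hA hnn hr.2 hr₀ hs
    refine ncard_gridClass_le M (x := fun i => x (Sum.inl i)) (y := fun j => x (Sum.inr j))
      (hr₀.trans_lt hs) (fun i => hx _) (fun j => hx _) (fun i => ?_) (fun j => ?_) k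
    · simpa only [hAdef, adjMatrix_rowColumnGraph_mulVec_inl] using hAx (Sum.inl i)
    · simpa only [hAdef, adjMatrix_rowColumnGraph_mulVec_inr] using hAx (Sum.inr j)
  · rw [IsGraphSpectralRadius]
    convert hr
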